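/- Let $G=(V,E)$ be a finite graph, possibly with loops and multiple edges, with nonnegative real edge weights $\lambda=(\lambda_e)_{e\in E}$. For $H\subseteq E$ let $\deg(H,v)$ be the degree of the vertex $v$ in the spanning subgraph $(V,H)$, where a loop counts twice. For $f,g:V\to\mathbb{N}$ put $u^{(v)}_k=1$ if $f(v)\le k\le g(v)$ and $u^{(v)}_k=0$ otherwise, and let $$Z(G,\lambda,u;x)=\sum_{H\subseteq E}\Big(\prod_{e\in H}\lambda_e\Big)\prod_{v\in V}u^{(v)}_{\deg(H,v)}\,x_v^{\deg(H,v)}.$$ For $0<\theta\le\pi$ let $S[\theta]=\{z\in\mathbb{C}: z\ne0,\ |\arg z|<\theta\}$, with $-\pi<\arg z\le\pi$. A polynomial in complex variables is called $S[\theta]$-nonvanishing if it is identically zero or has no zero with all coordinates in $S[\theta]$. Suppose that $f(v)\le g(v)\le f(v)+1$ for every $v\in V$. Then: (1) $Z(G,\lambda,u;x)$ is $S[\pi/2]$-nonvanishing. (2) The univariate specialization $Z(G,\lambda,u;y^{1/2}\mathbf{1})$, obtained by setting $x_v=y^{1/2}$ for all $v$ (for either choice of the square root), is the polynomial $\sum_{H\subseteq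 E}\big(\prod_{e\in H}\lambda_e\big)\big(\prod_{v\in V}u^{(v)}_{\deg(H,v)}\big)y^{|H|}$ in $y$. It is $S[\pi]$-nonvanishing; that is, unless it is identically zero, all its complex zeros are real and nonpositive. (3) In the special case $f\equiv0$, $g\equiv1$, the polynomial $Z(G,\lambda,u;x)$ is the weighted multivariate matching polynomial $\sum_M\big(\prod_{e\in M}\lambda_e\big)\prod_{v\in V}x_v^{\deg(M,v)}$, where $M$ runs over the matchings of $G$ (sets of non-loop edges no two of which share an end). It is nonzero whenever $x_v\in S[\pi/2]$ for all $v\in V$ (the multivariate Heilmann–Lieb theorem). -/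

import Mathlib

noncomputable section

namespace HeilmannLieb

/-- The open sector `S[θ]` centered on the positive real axis. `Complex.arg` takes values in
`(-π, π]`. -/
def sector (θ : ℝ) : Set ℂ := {z | z ≠ 0 ∧ |Complex.arg z| < θ}

/-- A multivariate polynomial `F` is `A`-nonvanishing if it is identically zero, or has no zero
all of whose coordinates lie in `A`. -/
def IsNonvanishing {σ : Type*} (A : Set ℂ) (F : MvPolynomial σ ℂ) : Prop :=
  F = 0 ∨ ∀ z : σ → ℂ, (∀ v, z v ∈ A) → MvPolynomial.eval z F ≠ 0

/-- The same notion for polynomials in one variable. -/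
def IsNonvanishing₁ (A : Set ℂ) (F : Polynomial ℂ) : Prop :=
  F = 0 ∨ ∀ z ∈ A, F.eval z ≠ 0

variable {α β : Type*} (G : Graph α β)

open Classical in
/-- The degree of the vertex `v` in the spanning subgraph of the multigraph `G` with edge set `H`.
A loop at `v` contributes two. -/
def deg (H : Finset G.edgeSet) (v : G.vertexSet) : ℕ :=
  ∑ e ∈ H, if G.IsLoopAt e v then 2 else if G.Inc e v then 1 else 0

/-- The weight `λ^H = ∏_{e ∈ H} λ_e` of a set of edges. -/
def edgeWeight (w : G.edgeSet → ℂ) (H : Finset G.edgeSet) : ℂ := ∏ e ∈ H, w e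

/-- The monomial `x^{deg H} = ∏_v x_v^{deg(H,v)}`. -/
def degMonomial [Fintype G.vertexSet] (H : Finset G.edgeSet) : MvPolynomial G.vertexSet ℂ :=
  ∏ v : G.vertexSet, MvPolynomial.X v ^ deg G H v

/-- The weight `u_{deg H} = ∏_v u^{(v)}_{deg(H,v)}`. Only the activities `u v k` with
`k ≤ deg(G,v)` are ever used. -/
def activityWeight [Fintype G.vertexSet] (u : G.vertexSet → ℕ → ℂ) (H : Finset G.edgeSet) : ℂ :=
  ∏ v : G.vertexSet, u v (deg G H v)

/-- The polynomial `Z(G,λ,u;x) = ∑_{H ⊆ E} λ^H u_{deg H} x^{deg H}`. -/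
def Z [Fintype G.vertexSet] [Fintype G.edgeSet] (w : G.edgeSet → ℂ) (u : G.vertexSet → ℕ → ℂ) :
    MvPolynomial G.vertexSet ℂ :=
  ∑ H : Finset G.edgeSet,
    MvPolynomial.C (edgeWeight G w H * activityWeight G u H) * degMonomial G H

/-- The polynomial `∑_{H ⊆ E} λ^H u_{deg H} y^{|H|}` in one variable. -/
def univariateZ [Fintype G.vertexSet] [Fintype G.edgeSet]
    (w : G.edgeSet → ℂ) (u : G.vertexSet → ℕ → ℂ) : Polynomial ℂ :=
  ∑ H : Finset G.edgeSet,
    Polynomial.C (edgeWeight G w H * activityWeight G u H) * Polynomial.X ^ H.card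

/-- The activities `u_k^{(v)} = 1` if `f(v) ≤ k ≤ g(v)`, and `0` otherwise. -/
def degreeConstraint {ι : Type*} (f g : ι → ℕ) (v : ι) (k : ℕ) : ℂ :=
  if f v ≤ k ∧ k ≤ g v then 1 else 0

/-- A matching: a set of edges containing no loop, in which no two distinct edges share an end. -/
def IsMatching (M : Finset G.edgeSet) : Prop :=
  (∀ e ∈ M, ∀ v, ¬ G.IsLoopAt e v) ∧
    ∀ e ∈ M, ∀ e' ∈ M, e ≠ e' → ∀ v, ¬ (G.Inc e v ∧ G.Inc e' v)

open Classical in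
/-- The edge-weighted multivariate matching polynomial `∑_M λ^M x^{deg M}`, summed over all
matchings `M` of `G`. -/
def matchingPolynomial [Fintype G.vertexSet] [Fintype G.edgeSet] (w : G.edgeSet → ℂ) :
    MvPolynomial G.vertexSet ℂ :=
  ∑ M : Finset G.edgeSet with IsMatching G M,
    MvPolynomial.C (edgeWeight G w M) * degMonomial G M

end HeilmannLieb

end

namespace HeilmannLieb

open Finset Filter Topology

/-! Cut every edge into two half-edges with independent variables `z e` and `w e`. The generating
polynomial of all sets of half-edges, with the degree constraints imposed, factors over the
vertices. The factor at a vertex is a sum of at most two consecutive terms `x ^ k * elemSymm y s k`.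
For variables in the open right half-plane it cannot vanish, because `elemSymm y s (k + 1) /
elemSymm y s k` lies there too (`re_elemSymm_div_pos`, `vertexSum_ne_zero`).

Gluing the halves of an edge of weight `l` turns `A + s B + t C + s t D` into `A + l D`. Up to an
error that vanishes with `ε`, this is the value at a diagonal point `s = t` of the half-plane, since
a quadratic whose roots have product `-l ≤ 0` has a root of nonnegative real part
(`contract_ne_zero`). For `ε > 0` all edges can be glued in turn without creating zeros
(`sum_halfWeight_ne_zero`). A Hurwitz-type limit `ε → 0` then leaves either the zero polynomial or a
nonvanishing one (`eq_zero_or_ne_zero_of_tendsto`). The univariate statement follows because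
squaring maps the right half-plane onto the slit plane. -/

/-! ### Elementary symmetric functions in the right half-plane -/

/-- The elementary symmetric function of degree `k` in the values `y i`, `i ∈ s`. -/
def elemSymm {ι : Type*} (y : ι → ℂ) (s : Finset ι) (k : ℕ) : ℂ :=
  ∑ t ∈ s.powersetCard k, ∏ i ∈ t, y i

lemma elemSymm_eq_erase {ι : Type*} [DecidableEq ι] (y : ι → ℂ) {s : Finset ι} {i : ι} (hi : i ∈ s)
    (k : ℕ) :
    elemSymm y s (k + 1) = elemSymm y (s.erase i) (k + 1) + y i * elemSymm y (s.erase i) k := by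
  unfold elemSymm
  conv_lhs => rw [← insert_erase hi]
  rw [powersetCard_succ_insert (notMem_erase i s), sum_union, sum_image, mul_sum]
  · congr 1
    refine sum_congr rfl fun t ht => ?_
    rw [prod_insert]
    exact fun h => notMem_erase i s ((mem_powersetCard.1 ht).1 h)
  · intro t ht t' ht' h
    have h1 : i ∉ t := fun h => notMem_erase i s ((mem_powersetCard.1 ht).1 h)
    have h2 : i ∉ t' := fun h => notMem_erase i s ((mem_powersetCard.1 ht').1 h)
    rw [← erase_insert h1, ← erase_insert h2, h]
  · rw [disjoint_left]
    intro t ht ht'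
    obtain ⟨t', -, rfl⟩ := mem_image.1 ht'
    exact notMem_erase i s ((mem_powersetCard.1 ht).1 (mem_insert_self i t'))

/-- Double counting of pairs (a set of size `k + 1`, a marked element of it). -/
lemma succ_mul_elemSymm {ι : Type*} [DecidableEq ι] (y : ι → ℂ) (s : Finset ι) (k : ℕ) :
    ((k : ℂ) + 1) * elemSymm y s (k + 1) = ∑ i ∈ s, y i * elemSymm y (s.erase i) k := by
  unfold elemSymm
  have h1 : ((k : ℂ) + 1) * ∑ t ∈ s.powersetCard (k + 1), ∏ i ∈ t, y i
      = ∑ t ∈ s.powersetCard (k + 1), ∑ i ∈ t, y i * ∏ j ∈ t.erase i, y j := by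
    rw [mul_sum]
    refine sum_congr rfl fun t ht => ?_
    rw [sum_congr rfl fun i hi => mul_prod_erase t y hi, sum_const, (mem_powersetCard.1 ht).2]
    simp
  rw [h1]
  simp_rw [mul_sum]
  rw [sum_sigma', sum_sigma']
  refine sum_bij' (fun p _ => ⟨p.2, p.1.erase p.2⟩) (fun p _ => ⟨insert p.1 p.2, p.1⟩) ?_ ?_ ?_ ?_ ?_
  · rintro ⟨t, i⟩ h
    simp only [mem_sigma, mem_powersetCard] at h ⊢
    exact ⟨h.1.1 h.2, erase_subset_erase i h.1.1, by rw [card_erase_of_mem h.2, h.1.2]; rfl⟩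
  · rintro ⟨i, t⟩ h
    simp only [mem_sigma, mem_powersetCard] at h ⊢
    have hi : i ∉ t := fun hi => notMem_erase i s (h.2.1 hi)
    exact ⟨⟨insert_subset h.1 (h.2.1.trans (erase_subset i s)), by
      rw [card_insert_of_notMem hi, h.2.2]⟩, mem_insert_self i t⟩
  · rintro ⟨t, i⟩ h
    simp only [mem_sigma] at h
    simp [insert_erase h.2]
  · rintro ⟨i, t⟩ h
    simp only [mem_sigma, mem_powersetCard] at h
    have hi : i ∉ t := fun hi => notMem_erase i s (h.2.1 hi)
    simp [erase_insert hi]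
  · rintro ⟨t, i⟩ h
    rfl

lemma re_inv_pos {z : ℂ} (hz : 0 < z.re) : 0 < (z⁻¹).re := by
  have : z ≠ 0 := by rintro rfl; simp at hz
  rw [Complex.inv_re]
  exact div_pos hz (Complex.normSq_pos.2 this)

/-- Consecutive elementary symmetric functions of numbers in the open right half-plane have
a ratio in the open right half-plane. -/
lemma re_elemSymm_div_pos {ι : Type*} [DecidableEq ι] (y : ι → ℂ) (hy : ∀ i, 0 < (y i).re) (k : ℕ) :
    ∀ s : Finset ι, k < #s → 0 < (elemSymm y s (k + 1) / elemSymm y s k).re := by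
  induction k with
  | zero =>
    intro s hs
    have := succ_mul_elemSymm y s 0
    simp only [elemSymm, powersetCard_zero, sum_singleton, prod_empty, mul_one, Nat.cast_zero,
      zero_add, one_mul] at this
    simp only [elemSymm, powersetCard_zero, sum_singleton, prod_empty, div_one, zero_add, this]
    rw [Complex.re_sum]
    exact sum_pos (fun i _ => hy i) (card_pos.1 hs)
  | succ k ih =>
    intro s hs
    have key : ∀ i ∈ s, 0 < (y i * elemSymm y (s.erase i) (k + 1) / elemSymm y s (k + 1)).re := by
      intro i hi
      have h := ih (s.erase i) (by rw [card_erase_of_mem hi]; omega)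
      have hi0 : y i ≠ 0 := fun h0 => by simpa [h0] using hy i
      have h1 : elemSymm y (s.erase i) (k + 1) ≠ 0 := fun h0 => by simp [h0] at h
      have h2 := re_inv_pos h
      rw [inv_div] at h2
      -- Inverting turns the quotient into a sum of two numbers in the right half-plane, which is
      -- closed under sums and inverses; the second is the inverse of the ratio given by induction
      -- for `s.erase i`.
      have h3 : y i * elemSymm y (s.erase i) (k + 1) / elemSymm y s (k + 1) =
          ((y i)⁻¹ + elemSymm y (s.erase i) k / elemSymm y (s.erase i) (k + 1))⁻¹ := by
        rw [elemSymm_eq_erase y hi k, ← inv_div]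
        congr 1
        field_simp
      rw [h3]
      apply re_inv_pos
      rw [Complex.add_re]
      exact add_pos (re_inv_pos (hy i)) h2
    have h := succ_mul_elemSymm y s (k + 1)
    have hk : ((k + 1 : ℕ) : ℂ) + 1 ≠ 0 := by exact_mod_cast (k + 1).succ_ne_zero
    have h' : elemSymm y s (k + 1 + 1) / elemSymm y s (k + 1) = ((k + 1 + 1 : ℕ) : ℝ)⁻¹ •
        ∑ i ∈ s, y i * elemSymm y (s.erase i) (k + 1) / elemSymm y s (k + 1) := by
      rw [← sum_div, ← h, Complex.real_smul]
      push_cast at hk ⊢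
      field_simp
    rw [h', Complex.smul_re, Complex.re_sum, smul_eq_mul]
    exact mul_pos (by positivity) (sum_pos key (card_pos.1 (by omega)))

lemma elemSymm_ne_zero {ι : Type*} [DecidableEq ι] (y : ι → ℂ) (hy : ∀ i, 0 < (y i).re)
    {s : Finset ι} {k : ℕ} (hk : k ≤ #s) : elemSymm y s k ≠ 0 := by
  cases k with
  | zero => simp [elemSymm]
  | succ k =>
    intro h
    simpa [h] using re_elemSymm_div_pos y hy k s hk

/-- At most the terms of degree `f` and `f + 1` survive. After a nonzero factor is taken out, two
surviving terms leave `x` plus an inverse ratio of consecutive `elemSymm`, which has positive real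
part. The bound `f ≤ #s` ensures that the term of degree `f` is present. -/
lemma vertexSum_ne_zero {ι : Type*} [DecidableEq ι] {f g : ℕ} (hfg : f ≤ g) (hgf : g ≤ f + 1)
    (y : ι → ℂ) (hy : ∀ i, 0 < (y i).re) {x : ℂ} (hx : 0 < x.re) {s : Finset ι} (hs : f ≤ #s) :
    ∑ t ∈ s.powerset, (if f ≤ #t ∧ #t ≤ g then (1 : ℂ) else 0) * x ^ #t * ∏ i ∈ t, y i ≠ 0 := by
  have hx0 : x ≠ 0 := fun h => by simp [h] at hx
  have h1 : ∑ t ∈ s.powerset, (if f ≤ #t ∧ #t ≤ g then (1 : ℂ) else 0) * x ^ #t * ∏ i ∈ t, y i =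
      ∑ j ∈ range (#s + 1), (if f ≤ j ∧ j ≤ g then (1 : ℂ) else 0) * x ^ j * elemSymm y s j := by
    rw [sum_powerset]
    refine sum_congr rfl fun j _ => ?_
    rw [elemSymm, mul_sum]
    refine sum_congr rfl fun t ht => ?_
    rw [(mem_powersetCard.1 ht).2]
  have hf := elemSymm_ne_zero y hy hs
  have h2 : ∑ j ∈ range (#s + 1), (if f ≤ j ∧ j ≤ g then (1 : ℂ) else 0) * x ^ j * elemSymm y s j =
      ∑ j ∈ range (#s + 1), ((if j = f then x ^ j * elemSymm y s j else 0) +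
        if j = f + 1 then (if g = f + 1 then x ^ j * elemSymm y s j else 0) else 0) := by
    refine sum_congr rfl fun j _ => ?_
    by_cases h1 : j = f
    · subst h1; simp [hfg]
    · by_cases h2 : j = f + 1
      · subst h2
        by_cases h3 : g = f + 1
        · simp [h3]
        · have : ¬ (f + 1 ≤ g) := by omega
          simp [h3, this]
      · have : ¬ (f ≤ j ∧ j ≤ g) := by omega
        simp [h1, h2, this]
  rw [h1, h2, sum_add_distrib, sum_ite_eq', sum_ite_eq', if_pos (by simpa using by omega)]
  by_cases hc : f + 1 ∈ range (#s + 1) ∧ g = f + 1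
  · rw [if_pos hc.1, if_pos hc.2]
    have hr := re_elemSymm_div_pos y hy f s (by simpa using hc.1)
    have hr' := re_inv_pos hr
    rw [inv_div] at hr'
    have hf1 : elemSymm y s (f + 1) ≠ 0 := fun h => by simp [h] at hr
    have : x ^ f * elemSymm y s f + x ^ (f + 1) * elemSymm y s (f + 1) =
        x ^ f * elemSymm y s (f + 1) * (elemSymm y s f / elemSymm y s (f + 1) + x) := by
      field_simp
      ring
    rw [this]
    refine mul_ne_zero (mul_ne_zero (pow_ne_zero _ hx0) hf1) fun h => ?_
    have := congrArg Complex.re h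
    rw [Complex.add_re, Complex.zero_re] at this
    linarith
  · have : (if f + 1 ∈ range (#s + 1) then
        (if g = f + 1 then x ^ (f + 1) * elemSymm y s (f + 1) else 0) else 0) = 0 := by
      rw [← ite_and, if_neg hc]
    rw [this, add_zero]
    exact mul_ne_zero (pow_ne_zero _ hx0) hf

/-! ### Half-edges and factorization over the vertices -/

/-- A sum over all subsets of a set fibered over `V` factors over the fibers. -/
lemma sum_finset_prod_fiber {V ι : Type*} [Fintype V] [DecidableEq V] [Fintype ι] [DecidableEq ι]
    (c : ι → V) (φ : V → Finset ι → ℂ) :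
    ∑ s : Finset ι, ∏ v, φ v {i ∈ s | c i = v} =
      ∏ v, ∑ t ∈ ({i | c i = v} : Finset ι).powerset, φ v t := by
  rw [prod_univ_sum]
  have key : ∀ p : V → Finset ι, (∀ v, p v ⊆ ({i | c i = v} : Finset ι)) →
      ∀ v, {i ∈ univ.biUnion p | c i = v} = p v := by
    intro p hp v
    ext i
    simp only [mem_filter, mem_biUnion, mem_univ, true_and]
    constructor
    · rintro ⟨⟨v', hi⟩, rfl⟩
      have := hp v' hi
      simp only [mem_filter, mem_univ, true_and] at this
      rwa [this]
    · intro hi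
      exact ⟨⟨v, hi⟩, by simpa using hp v hi⟩
  refine sum_bij' (fun s _ v => {i ∈ s | c i = v}) (fun p _ => univ.biUnion p) ?_ ?_ ?_ ?_ ?_
  · intro s _
    simp only [Fintype.mem_piFinset, mem_powerset]
    exact fun v => filter_subset_filter _ (subset_univ s)
  · simp
  · intro s _
    ext i
    simp
  · intro p hp
    simp only [Fintype.mem_piFinset, mem_powerset] at hp
    exact funext (key p hp)
  · intros; rfl

/-- The number of half-edges at `v` in a set of half-edges `(S, T)`, where the edge `e` consists
of one half-edge at `a e` and one at `b e`. -/
def halfDeg {V E : Type*} [DecidableEq V] (a b : E → V) (S T : Finset E) (v : V) : ℕ :=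
  #{e ∈ S | a e = v} + #{e ∈ T | b e = v}

lemma card_disjSum_filter {V E : Type*} [DecidableEq V] (a b : E → V) (S T : Finset E) (v : V) :
    #{i ∈ S.disjSum T | Sum.elim a b i = v} = halfDeg a b S T v := by
  have : {i ∈ S.disjSum T | Sum.elim a b i = v} =
      ({e ∈ S | a e = v} : Finset E).disjSum {e ∈ T | b e = v} := by
    ext (e | e) <;> simp
  rw [this, card_disjSum, halfDeg]

/-- A pair `(S, T)` is one subset of `E ⊕ E`, and `Sum.elim a b` sends each half-edge to its vertex,
so the sum splits along the fibers. -/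
lemma sum_halfEdges_eq_prod {V E : Type*} [Fintype V] [DecidableEq V] [Fintype E] [DecidableEq E]
    (a b : E → V) (u : V → ℕ → ℂ) (x : V → ℂ) (z w : E → ℂ) :
    ∑ S : Finset E, ∑ T : Finset E,
      (∏ v, u v (halfDeg a b S T v) * x v ^ halfDeg a b S T v) * ((∏ e ∈ S, z e) * ∏ e ∈ T, w e) =
    ∏ v, ∑ t ∈ ({i | Sum.elim a b i = v} : Finset (E ⊕ E)).powerset,
      u v #t * x v ^ #t * ∏ i ∈ t, Sum.elim z w i := by
  rw [← sum_finset_prod_fiber (Sum.elim a b)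
    (fun v t => u v #t * x v ^ #t * ∏ i ∈ t, Sum.elim z w i), ← Fintype.sum_prod_type',
    ← Finset.sumEquiv.symm.toEquiv.sum_comp]
  refine sum_congr rfl fun p _ => ?_
  have : Finset.sumEquiv.symm.toEquiv p = p.1.disjSum p.2 := rfl
  rw [this, prod_mul_distrib (f := fun v => _ * _)]
  congr 1
  · simp_rw [card_disjSum_filter]
  · rw [prod_fiberwise, prod_disjSum]
    simp

/-! ### Contraction of half-edges -/

/-- A complex quadratic whose roots have a nonpositive product has a root in the closed right
half-plane. -/
lemma exists_root_re_nonneg (B : ℂ) {l : ℝ} (hl : 0 ≤ l) :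
    ∃ s : ℂ, 0 ≤ s.re ∧ s ^ 2 + B * s - l = 0 := by
  obtain ⟨d, hd⟩ := IsAlgClosed.exists_pow_nat_eq (B ^ 2 + 4 * l) (n := 2) (by norm_num)
  by_cases h : 0 ≤ ((-B + d) / 2).re
  · exact ⟨_, h, by linear_combination hd / 4⟩
  · refine ⟨(-B - d) / 2, ?_, by linear_combination hd / 4⟩
    have hmul : ((-B + d) / 2) * ((-B - d) / 2) = -l := by linear_combination -hd / 4
    set r := (-B + d) / 2
    set r' := (-B - d) / 2
    have hr : r ≠ 0 := fun h0 => h (by simp [h0])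
    -- From `r * r' = -l`, the other root is a nonnegative multiple of `-conj r`, whose real part is
    -- positive.
    have : r' = (((l / Complex.normSq r : ℝ)) : ℂ) * (-(starRingEnd ℂ) r) := by
      have hn : ((Complex.normSq r : ℝ) : ℂ) ≠ 0 := by
        exact_mod_cast (Complex.normSq_pos.2 hr).ne'
      apply mul_left_cancel₀ hr
      rw [hmul]
      push_cast
      have := Complex.mul_conj r
      rw [show r * ((l : ℂ) / Complex.normSq r * -(starRingEnd ℂ) r) =
        -((l : ℂ) / Complex.normSq r * (r * (starRingEnd ℂ) r)) by ring, this,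
        div_mul_cancel₀ _ hn]
    rw [this, Complex.re_ofReal_mul]
    refine mul_nonneg (div_nonneg hl (Complex.normSq_nonneg r)) ?_
    rw [Complex.neg_re, Complex.conj_re]
    linarith

/-- Contraction of one pair of variables in a polynomial of degree one in each of them. -/
lemma contract_ne_zero {A B C D : ℂ} {l ε : ℝ} (hl : 0 ≤ l) (hε : 0 < ε)
    (h : ∀ s t : ℂ, 0 < s.re → 0 < t.re → A + s * B + t * C + s * t * D ≠ 0) :
    A + ε * B + ε * C + (l + ε ^ 2) * D ≠ 0 := by
  intro h0
  have hpos : ∀ s : ℂ, 0 ≤ s.re → 0 < (s + ε).re := fun s hs => by simp; linarith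
  by_cases hD : D = 0
  · subst hD
    refine h ε ε (by simpa) (by simpa) ?_
    linear_combination h0
  · obtain ⟨s, hs, hs0⟩ := exists_root_re_nonneg ((B + C + 2 * ε * D) / D) hl
    refine h (s + ε) (s + ε) (hpos s hs) (hpos s hs) ?_
    have : D * s ^ 2 + (B + C + 2 * ε * D) * s - l * D = 0 := by
      field_simp at hs0
      linear_combination hs0
    linear_combination h0 + this

/-- The weight with which an edge contributes to the perturbed contraction, according to which of
its half-edges are present. -/
def halfWeight (l ε : ℝ) (p q : Prop) [Decidable p] [Decidable q] : ℂ :=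
  if p then (if q then l + ε ^ 2 else ε) else (if q then ε else 1)

/-- Induction contracts one edge at a time. The coefficients `c` are arbitrary because each
contraction replaces them by new ones. -/
lemma sum_halfWeight_ne_zero {E : Type*} [DecidableEq E] (l : E → ℝ) (hl : ∀ e, 0 ≤ l e)
    {ε : ℝ} (hε : 0 < ε) (F : Finset E) : ∀ c : Finset E → Finset E → ℂ,
    (∀ z w : E → ℂ, (∀ e, 0 < (z e).re) → (∀ e, 0 < (w e).re) →
      ∑ S ∈ F.powerset, ∑ T ∈ F.powerset, c S T * ((∏ e ∈ S, z e) * ∏ e ∈ T, w e) ≠ 0) →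
    ∑ S ∈ F.powerset, ∑ T ∈ F.powerset, c S T * ∏ e ∈ F, halfWeight (l e) ε (e ∈ S) (e ∈ T) ≠ 0 := by
  induction F using Finset.induction_on with
  | empty =>
    intro c h
    simpa using h 1 1 (by simp) (by simp)
  | insert a F ha ih =>
    intro c h
    have hmem : ∀ {S : Finset E}, S ∈ F.powerset → a ∉ S := fun hS h => ha (mem_powerset.1 hS h)
    have h' := ih (fun S T => c S T + ε * c (insert a S) T + ε * c S (insert a T) +
      (l a + ε ^ 2) * c (insert a S) (insert a T)) ?_
    · convert h' using 1
      simp_rw [sum_powerset_insert ha]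
      simp_rw [← sum_add_distrib]
      refine sum_congr rfl fun S hS => sum_congr rfl fun T hT => ?_
      have key : ∀ S' T' : Finset E, (∀ e ∈ F, e ∈ S' ↔ e ∈ S) → (∀ e ∈ F, e ∈ T' ↔ e ∈ T) →
          ∏ e ∈ F, halfWeight (l e) ε (e ∈ S') (e ∈ T') =
            ∏ e ∈ F, halfWeight (l e) ε (e ∈ S) (e ∈ T) := by
        intro S' T' h1 h2
        refine prod_congr rfl fun e he => ?_
        simp [halfWeight, h1 e he, h2 e he]
      have hins : ∀ U : Finset E, ∀ e ∈ F, e ∈ insert a U ↔ e ∈ U := by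
        intro U e he
        have : e ≠ a := fun h => ha (h ▸ he)
        simp [this]
      simp_rw [prod_insert ha]
      rw [key _ _ (hins S) (fun _ _ => Iff.rfl), key _ _ (fun _ _ => Iff.rfl) (hins T),
        key _ _ (hins S) (hins T)]
      simp only [halfWeight, hmem hS, hmem hT, mem_insert_self, if_true, if_false]
      ring
    · intro z w hz hw
      have := contract_ne_zero (hl a) hε
        (A := ∑ S ∈ F.powerset, ∑ T ∈ F.powerset, c S T * ((∏ e ∈ S, z e) * ∏ e ∈ T, w e))
        (B := ∑ S ∈ F.powerset, ∑ T ∈ F.powerset,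
          c (insert a S) T * ((∏ e ∈ S, z e) * ∏ e ∈ T, w e))
        (C := ∑ S ∈ F.powerset, ∑ T ∈ F.powerset,
          c S (insert a T) * ((∏ e ∈ S, z e) * ∏ e ∈ T, w e))
        (D := ∑ S ∈ F.powerset, ∑ T ∈ F.powerset,
          c (insert a S) (insert a T) * ((∏ e ∈ S, z e) * ∏ e ∈ T, w e)) ?_
      · convert this using 1
        simp_rw [mul_sum, ← sum_add_distrib]
        refine sum_congr rfl fun S hS => sum_congr rfl fun T hT => ?_
        ring
      · intro s t hs ht
        -- The values at `a` are overwritten by the two free variables `s` and `t` of the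
        -- contraction.
        have hupd : ∀ (r : ℂ) (y : E → ℂ), 0 < r.re → (∀ e, 0 < (y e).re) →
            ∀ e, 0 < (Function.update y a r e).re := by
          intro r y hr hy e
          by_cases he : e = a
          · subst he; simpa
          · simpa [he] using hy e
        have hprod : ∀ (r : ℂ) (y : E → ℂ) {U : Finset E}, a ∉ U →
            ∏ e ∈ U, Function.update y a r e = ∏ e ∈ U, y e := by
          intro r y U hU
          exact prod_update_of_notMem hU y r
        convert h (Function.update z a s) (Function.update w a t) (hupd s z hs hz)
          (hupd t w ht hw) using 1
        simp_rw [sum_powerset_insert ha, mul_sum, ← sum_add_distrib]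
        refine sum_congr rfl fun S hS => sum_congr rfl fun T hT => ?_
        rw [prod_insert (hmem hS), prod_insert (hmem hT), hprod s z (hmem hS),
          hprod t w (hmem hT), Function.update_self, Function.update_self]
        ring

/-! ### Limits of nonvanishing polynomials -/

/-- A polynomial of degree at most `N` without zeros in a disc is bounded there by `2 ^ N` times
its absolute value at the center. -/
lemma norm_eval_le_of_ne_zero {p : Polynomial ℂ} {N : ℕ} (hN : p.natDegree ≤ N) {δ : ℝ}
    (hp : ∀ s : ℂ, ‖s‖ < δ → p.eval s ≠ 0) {s : ℂ} (hs : ‖s‖ < δ) :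
    ‖p.eval s‖ ≤ 2 ^ N * ‖p.eval 0‖ := by
  have hev : ∀ t, p.eval t = p.leadingCoeff * (p.roots.map fun r => t - r).prod := by
    intro t
    conv_lhs => rw [(IsAlgClosed.splits p).eq_prod_roots]
    simp [Polynomial.eval_multiset_prod, Multiset.map_map]
  have hp0 : p ≠ 0 := fun h => by simpa [h] using hp s hs
  have hδ : 0 < δ := (norm_nonneg s).trans_lt hs
  have hroots : ∀ r ∈ p.roots, ‖s - r‖ ≤ 2 * ‖0 - r‖ := by
    intro r hr
    have hr' : δ ≤ ‖r‖ := by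
      by_contra! h
      exact hp r h ((Polynomial.mem_roots hp0).1 hr)
    rw [zero_sub, norm_neg]
    linarith [norm_sub_le s r]
  have hprod : ∀ m : Multiset ℂ, (∀ r ∈ m, ‖s - r‖ ≤ 2 * ‖0 - r‖) →
      ‖(m.map fun r => s - r).prod‖ ≤ 2 ^ m.card * ‖(m.map fun r => 0 - r).prod‖ := by
    intro m
    induction m using Multiset.induction_on with
    | empty => simp
    | cons r m ih =>
      intro h
      have h1 := h r (Multiset.mem_cons_self r m)
      have h2 := ih fun r' hr' => h r' (Multiset.mem_cons_of_mem hr')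
      simp only [Multiset.map_cons, Multiset.prod_cons, norm_mul, Multiset.card_cons]
      calc _ ≤ (2 * ‖0 - r‖) * (2 ^ m.card * ‖(m.map fun r => 0 - r).prod‖) := by gcongr
        _ = _ := by ring
  rw [hev s, hev 0, norm_mul, norm_mul]
  calc _ ≤ ‖p.leadingCoeff‖ * (2 ^ p.roots.card * ‖(p.roots.map fun r => 0 - r).prod‖) := by
        gcongr; exact hprod _ hroots
    _ ≤ ‖p.leadingCoeff‖ * (2 ^ N * ‖(p.roots.map fun r => 0 - r).prod‖) := by
        gcongr
        · norm_num
        · exact (Polynomial.card_roots' p).trans hN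
    _ = _ := by ring

/-- A limit of polynomials without zeros in the product of right half-planes is zero or has no
zero there. -/
lemma eq_zero_or_ne_zero_of_tendsto {σ ι : Type*} [Finite σ] [Fintype ι]
    (m : ι → MvPolynomial σ ℂ) (k : ℝ → ι → ℂ)
    (hk : ∀ i, Continuous fun ε => k ε i)
    (h : ∀ ε, 0 < ε → ∀ x : σ → ℂ, (∀ v, 0 < (x v).re) → ∑ i, k ε i * (m i).eval x ≠ 0)
    {F : MvPolynomial σ ℂ} (hF : ∀ x, F.eval x = ∑ i, k 0 i * (m i).eval x) :
    F = 0 ∨ ∀ x : σ → ℂ, (∀ v, 0 < (x v).re) → F.eval x ≠ 0 := by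
  by_contra! hcon
  obtain ⟨hF0, x₀, hx₀, hz⟩ := hcon
  apply hF0
  refine MvPolynomial.funext fun x₁ => ?_
  rw [map_zero]
  -- Restriction to the complex line through the zero `x₀` (at `s = 0`) and an arbitrary point `x₁`
  -- (at `s = 1`).
  let L : MvPolynomial σ ℂ → Polynomial ℂ :=
    MvPolynomial.aeval fun v => Polynomial.C (x₀ v) + Polynomial.C (x₁ v - x₀ v) * Polynomial.X
  have hL : ∀ (p : MvPolynomial σ ℂ) (s : ℂ),
      (L p).eval s = p.eval fun v => x₀ v + (x₁ v - x₀ v) * s := by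
    intro p s
    induction p using MvPolynomial.induction_on with
    | C a => simp [L]
    | add p q hp hq => simp only [L, map_add, Polynomial.eval_add] at hp hq ⊢; rw [hp, hq]
    | mul_X p v hp => simp only [L, map_mul, Polynomial.eval_mul] at hp ⊢; rw [hp]; simp
  let q : ℝ → Polynomial ℂ := fun ε => ∑ i, Polynomial.C (k ε i) * L (m i)
  have hq : ∀ ε s, (q ε).eval s = ∑ i, k ε i * (m i).eval fun v => x₀ v + (x₁ v - x₀ v) * s := by
    intro ε s
    simp only [q, Polynomial.eval_finsetSum, Polynomial.eval_mul, Polynomial.eval_C, hL]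
  have hdeg : ∀ ε, (q ε).natDegree ≤ univ.sup fun i => (L (m i)).natDegree := by
    intro ε
    refine Polynomial.natDegree_sum_le_of_forall_le _ _ fun i hi => ?_
    exact (Polynomial.natDegree_C_mul_le _ _).trans
      (le_sup (f := fun i => (L (m i)).natDegree) hi)
  have hcont : ∀ s, Continuous fun ε => (q ε).eval s := by
    intro s
    simp_rw [hq]
    exact continuous_finsetSum _ fun i _ => (hk i).mul continuous_const
  obtain ⟨δ, hδ, hball⟩ : ∃ δ > 0, ∀ s : ℂ, ‖s‖ < δ → ∀ v, 0 < (x₀ v + (x₁ v - x₀ v) * s).re := by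
    have : ∀ᶠ s : ℂ in 𝓝 0, ∀ v, 0 < (x₀ v + (x₁ v - x₀ v) * s).re := by
      rw [eventually_all]
      intro v
      have hc : Continuous fun s : ℂ => (x₀ v + (x₁ v - x₀ v) * s).re := by fun_prop
      exact hc.continuousAt.eventually (lt_mem_nhds (by simpa using hx₀ v))
    obtain ⟨δ, hδ, hb⟩ := Metric.eventually_nhds_iff.1 this
    exact ⟨δ, hδ, fun s hs => hb (by simpa using hs)⟩
  have hq0 : (q 0).eval 0 = 0 := by
    rw [hq, ← hF]
    simpa using hz
  have hzero : ∀ s : ℂ, ‖s‖ < δ → (q 0).eval s = 0 := by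
    intro s hs
    have hle : ∀ᶠ ε in 𝓝[>] (0 : ℝ), ‖(q ε).eval s‖ ≤
        2 ^ (univ.sup fun i => (L (m i)).natDegree) * ‖(q ε).eval 0‖ := by
      filter_upwards [self_mem_nhdsWithin] with ε hε
      refine norm_eval_le_of_ne_zero (hdeg ε) (δ := δ) (fun t ht => ?_) hs
      rw [hq]
      exact h ε hε _ (hball t ht)
    -- The degree bound does not depend on `ε`, so the zero of the limit at the center forces it to
    -- vanish on the whole disc.
    have hlim := le_of_tendsto_of_tendsto
      (((hcont s).norm.tendsto 0).mono_left nhdsWithin_le_nhds)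
      (((continuous_const.mul (hcont 0).norm).tendsto 0).mono_left nhdsWithin_le_nhds) hle
    simp only [Pi.mul_apply, hq0, norm_zero, mul_zero] at hlim
    exact norm_le_zero_iff.1 hlim
  have hpoly : q 0 = 0 := by
    refine Polynomial.eq_zero_of_infinite_isRoot _ ?_
    refine Set.Infinite.mono (s := Metric.ball 0 δ) (fun s hs => hzero s (by simpa using hs)) ?_
    exact infinite_of_mem_nhds (0 : ℂ) (Metric.ball_mem_nhds 0 hδ)
  have := hq 0 1
  rw [hpoly, Polynomial.eval_zero] at this
  rw [hF, this]
  simp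

/-- At `ε = 0` an edge with exactly one half present has weight zero, so only genuine edge sets
remain. -/
lemma prod_halfWeight_zero {E : Type*} [Fintype E] [DecidableEq E] (l : E → ℝ) (S T : Finset E) :
    ∏ e, halfWeight (l e) 0 (e ∈ S) (e ∈ T) = if S = T then ∏ e ∈ S, (l e : ℂ) else 0 := by
  split_ifs with h
  · subst h
    rw [← prod_subset (subset_univ S)]
    · exact prod_congr rfl fun e he => by simp [halfWeight, he]
    · intro e _ he
      simp [halfWeight, he]
  · obtain ⟨e, he⟩ : ∃ e, ¬ (e ∈ S ↔ e ∈ T) := by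
      by_contra! hcon
      exact h (Finset.ext hcon)
    refine prod_eq_zero (mem_univ e) ?_
    by_cases h1 : e ∈ S <;> by_cases h2 : e ∈ T <;> simp_all [halfWeight]

/-- Nonvanishing of the degree-constrained subgraph polynomial, for a graph given by two end maps
`a b : E → V`. -/
lemma eq_zero_or_ne_zero_of_endMaps {V E : Type*} [Fintype V] [DecidableEq V] [Fintype E]
    [DecidableEq E] (a b : E → V) (l : E → ℝ) (hl : ∀ e, 0 ≤ l e) (f g : V → ℕ)
    (hfg : ∀ v, f v ≤ g v ∧ g v ≤ f v + 1) {F : MvPolynomial V ℂ}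
    (hF : ∀ x, F.eval x = ∑ H : Finset E, (∏ e ∈ H, (l e : ℂ)) *
      ∏ v, degreeConstraint f g v (halfDeg a b H H v) * x v ^ halfDeg a b H H v) :
    F = 0 ∨ ∀ x : V → ℂ, (∀ v, 0 < (x v).re) → F.eval x ≠ 0 := by
  -- If some vertex has fewer than `f v` half-edges, no edge set meets its constraint and `F` is
  -- zero.
  by_cases hdeg : ∀ v, f v ≤ #{i | Sum.elim a b i = v}
  · have hm : ∀ (S T : Finset E) (x : V → ℂ),
        (∏ v, MvPolynomial.C (degreeConstraint f g v (halfDeg a b S T v)) *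
          MvPolynomial.X v ^ halfDeg a b S T v : MvPolynomial V ℂ).eval x =
        ∏ v, degreeConstraint f g v (halfDeg a b S T v) * x v ^ halfDeg a b S T v := by
      intro S T x
      simp [map_prod]
    refine eq_zero_or_ne_zero_of_tendsto (ι := Finset E × Finset E)
      (fun p => ∏ v, MvPolynomial.C (degreeConstraint f g v (halfDeg a b p.1 p.2 v)) *
        MvPolynomial.X v ^ halfDeg a b p.1 p.2 v)
      (fun ε p => ∏ e, halfWeight (l e) ε (e ∈ p.1) (e ∈ p.2)) ?_ ?_ ?_
    · rintro ⟨S, T⟩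
      refine continuous_finsetProd _ fun e _ => ?_
      by_cases h1 : e ∈ S <;> by_cases h2 : e ∈ T <;> simp only [halfWeight, h1, h2, if_true,
        if_false] <;> fun_prop
    · intro ε hε x hx
      have := sum_halfWeight_ne_zero l hl hε univ
        (fun S T => ∏ v, degreeConstraint f g v (halfDeg a b S T v) * x v ^ halfDeg a b S T v) ?_
      · simp_rw [powerset_univ] at this
        intro h0
        apply this
        rw [← h0, Fintype.sum_prod_type]
        refine sum_congr rfl fun S _ => sum_congr rfl fun T _ => ?_
        rw [hm]
        exact mul_comm _ _
      · intro z w hz hw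
        simp_rw [powerset_univ]
        rw [sum_halfEdges_eq_prod a b (degreeConstraint f g) x z w, prod_ne_zero_iff]
        intro v _
        exact vertexSum_ne_zero (hfg v).1 (hfg v).2 _ (by rintro (e | e) <;> simp [hz, hw])
          (hx v) (hdeg v)
    · intro x
      rw [hF, Fintype.sum_prod_type]
      refine sum_congr rfl fun S _ => ?_
      simp_rw [hm, prod_halfWeight_zero, ite_mul, zero_mul]
      rw [sum_ite_eq, if_pos (mem_univ S)]
  · left
    push Not at hdeg
    obtain ⟨v, hv⟩ := hdeg
    refine MvPolynomial.funext fun x => ?_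
    rw [hF, map_zero]
    refine sum_eq_zero fun H _ => ?_
    rw [prod_eq_zero (mem_univ v), mul_zero]
    have : halfDeg a b H H v < f v := by
      rw [← card_disjSum_filter]
      exact (card_le_card (filter_subset_filter _ (subset_univ _))).trans_lt hv
    rw [degreeConstraint, if_neg (by omega), zero_mul]

/-! ### Sectors and square roots -/

lemma mem_sector_pi_div_two {z : ℂ} : z ∈ sector (Real.pi / 2) ↔ 0 < z.re := by
  simp only [sector, Set.mem_ofPred_eq, Complex.abs_arg_lt_pi_div_two_iff]
  constructor
  · rintro ⟨h0, h | h⟩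
    · exact h
    · exact absurd h h0
  · exact fun h => ⟨fun h0 => by simp [h0] at h, Or.inl h⟩

lemma mem_sector_pi {z : ℂ} : z ∈ sector Real.pi ↔ ¬ (z.im = 0 ∧ z.re ≤ 0) := by
  have h1 : |Complex.arg z| < Real.pi ↔ Complex.arg z ≠ Real.pi := by
    rw [abs_lt]
    exact ⟨fun h => h.2.ne, fun h => ⟨Complex.neg_pi_lt_arg z, (Complex.arg_le_pi z).lt_of_ne h⟩⟩
  simp only [sector, Set.mem_ofPred_eq, h1, ne_eq, Complex.arg_eq_pi_iff]
  rw [← not_or, not_iff_not, le_iff_lt_or_eq, Complex.ext_iff]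
  simp only [Complex.zero_re, Complex.zero_im]
  tauto

lemma exists_sq_eq_of_mem_sector_pi {y : ℂ} (hy : y ∈ sector Real.pi) :
    ∃ t ∈ sector (Real.pi / 2), t ^ 2 = y := by
  obtain ⟨t, ht⟩ := IsAlgClosed.exists_pow_nat_eq y (n := 2) (by norm_num)
  simp only [mem_sector_pi_div_two]
  rcases lt_trichotomy t.re 0 with h | h | h
  · exact ⟨-t, by simpa using h, by rw [neg_sq, ht]⟩
  -- A purely imaginary root would make `y` real and nonpositive.
  · refine absurd ?_ (mem_sector_pi.1 hy)
    rw [← ht, sq, Complex.mul_im, Complex.mul_re, h]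
    refine ⟨by simp, ?_⟩
    nlinarith [mul_self_nonneg t.im]
  · exact ⟨t, h, ht⟩

/-! ### Application to multigraphs -/

section Graph

variable {α β : Type*} (G : Graph α β)

lemma exists_endMaps : ∃ a b : G.edgeSet → G.vertexSet, ∀ e : G.edgeSet, G.IsLink e (a e) (b e) := by
  choose x y h using fun e : G.edgeSet => G.exists_isLink_of_mem_edgeSet e.2
  exact ⟨fun e => ⟨x e, (h e).left_mem⟩, fun e => ⟨y e, (h e).right_mem⟩, h⟩

lemma deg_eq_halfDeg [DecidableEq G.vertexSet] {a b : G.edgeSet → G.vertexSet}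
    (hab : ∀ e : G.edgeSet, G.IsLink e (a e) (b e)) (H : Finset G.edgeSet) (v : G.vertexSet) :
    deg G H v = halfDeg a b H H v := by
  classical
  rw [deg, halfDeg, card_filter, card_filter, ← sum_add_distrib]
  refine sum_congr rfl fun e _ => ?_
  have hloop : G.IsLoopAt e v ↔ a e = v ∧ b e = v := by
    rw [← Graph.isLink_self_iff, (hab e).isLink_iff, Subtype.ext_iff, Subtype.ext_iff]
    tauto
  have hinc : G.Inc e v ↔ a e = v ∨ b e = v := by
    constructor
    · intro h
      rcases h.eq_or_eq_of_isLink (hab e) with h | h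
      · exact Or.inl (Subtype.ext h.symm)
      · exact Or.inr (Subtype.ext h.symm)
    · rintro (rfl | rfl)
      · exact (hab e).inc_left
      · exact (hab e).inc_right
  by_cases h1 : a e = v <;> by_cases h2 : b e = v <;> simp [hloop, hinc, h1, h2]

/-- The handshake identity; it makes the specialization `x_v = t` a polynomial in `t ^ 2`. -/
lemma sum_deg [Fintype G.vertexSet] (H : Finset G.edgeSet) : ∑ v, deg G H v = 2 * #H := by
  classical
  obtain ⟨a, b, hab⟩ := exists_endMaps G
  simp_rw [deg_eq_halfDeg G hab, halfDeg, sum_add_distrib]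
  rw [← card_eq_sum_card_fiberwise (fun _ _ => mem_univ _),
    ← card_eq_sum_card_fiberwise (fun _ _ => mem_univ _), two_mul]

lemma eval_degMonomial [Fintype G.vertexSet] (x : G.vertexSet → ℂ) (H : Finset G.edgeSet) :
    (degMonomial G H).eval x = ∏ v, x v ^ deg G H v := by
  simp [degMonomial, map_prod]

lemma eval_Z [Fintype G.vertexSet] [Fintype G.edgeSet] (w : G.edgeSet → ℂ)
    (u : G.vertexSet → ℕ → ℂ) (x : G.vertexSet → ℂ) :
    (Z G w u).eval x = ∑ H : Finset G.edgeSet,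
      edgeWeight G w H * activityWeight G u H * ∏ v, x v ^ deg G H v := by
  simp [Z, eval_degMonomial]

/-- The degree-constrained subgraph polynomial is `S[π/2]`-nonvanishing. -/
lemma isNonvanishing_Z [Fintype G.vertexSet] [Fintype G.edgeSet] (w : G.edgeSet → ℝ)
    (hw : ∀ e, 0 ≤ w e) (f g : G.vertexSet → ℕ) (hfg : ∀ v, f v ≤ g v ∧ g v ≤ f v + 1) :
    IsNonvanishing (sector (Real.pi / 2)) (Z G (fun e => (w e : ℂ)) (degreeConstraint f g)) := by
  classical
  obtain ⟨a, b, hab⟩ := exists_endMaps G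
  simp only [IsNonvanishing, mem_sector_pi_div_two]
  refine eq_zero_or_ne_zero_of_endMaps a b w hw f g hfg fun x => ?_
  rw [eval_Z]
  refine sum_congr rfl fun H _ => ?_
  rw [mul_assoc, edgeWeight, activityWeight, ← prod_mul_distrib]
  simp_rw [deg_eq_halfDeg G hab]

/-- The univariate polynomial is the specialization of `Z` at a square root of the variable. -/
lemma eval_univariateZ [Fintype G.vertexSet] [Fintype G.edgeSet] (w : G.edgeSet → ℂ)
    (u : G.vertexSet → ℕ → ℂ) (t : ℂ) :
    (univariateZ G w u).eval (t ^ 2) = (Z G w u).eval fun _ => t := by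
  rw [eval_Z, univariateZ, Polynomial.eval_finsetSum]
  refine sum_congr rfl fun H _ => ?_
  rw [prod_pow_eq_pow_sum, sum_deg, pow_mul]
  simp

lemma isNonvanishing_univariateZ [Fintype G.vertexSet] [Fintype G.edgeSet] {w : G.edgeSet → ℂ}
    {u : G.vertexSet → ℕ → ℂ} (h : IsNonvanishing (sector (Real.pi / 2)) (Z G w u)) :
    IsNonvanishing₁ (sector Real.pi) (univariateZ G w u) := by
  rcases h with h | h
  · left
    refine Polynomial.funext fun y => ?_
    obtain ⟨t, rfl⟩ := IsAlgClosed.exists_pow_nat_eq y (n := 2) (by norm_num)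
    rw [eval_univariateZ, h, map_zero, Polynomial.eval_zero]
  · right
    intro y hy
    obtain ⟨t, ht, rfl⟩ := exists_sq_eq_of_mem_sector_pi hy
    rw [eval_univariateZ]
    exact h _ fun _ => ht

lemma isMatching_iff (M : Finset G.edgeSet) : IsMatching G M ↔ ∀ v, deg G M v ≤ 1 := by
  classical
  constructor
  · rintro ⟨h1, h2⟩ v
    have : deg G M v = #(M.filter fun e : G.edgeSet => G.Inc e v) := by
      rw [deg, card_filter]
      refine sum_congr rfl fun e he => ?_
      rw [if_neg (h1 e he v)]
    rw [this, card_le_one]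
    intro e he e' he'
    rw [mem_filter] at he he'
    by_contra hne
    exact h2 e he.1 e' he'.1 hne v ⟨he.2, he'.2⟩
  · intro h
    refine ⟨fun e he v hv => ?_, fun e he e' he' hne v hv => ?_⟩
    · have h1 := single_le_sum (f := fun e : G.edgeSet => if G.IsLoopAt e v then 2 else
        if G.Inc e v then 1 else 0) (fun _ _ => Nat.zero_le _) he
      have h2 := h ⟨v, hv.vertex_mem⟩
      simp only [hv, if_true] at h1
      have h3 := h1.trans h2
      omega
    · have h1 := sum_le_sum_of_subset (f := fun e : G.edgeSet => if G.IsLoopAt e v then 2 else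
        if G.Inc e v then 1 else 0) (s := {e, e'}) (insert_subset he (singleton_subset_iff.2 he'))
      have h2 := h1.trans (h ⟨v, hv.1.vertex_mem⟩)
      rw [sum_pair hne] at h2
      simp only [hv.1, hv.2, if_true] at h2
      split_ifs at h2 <;> omega

lemma Z_eq_matchingPolynomial [Fintype G.vertexSet] [Fintype G.edgeSet] (w : G.edgeSet → ℂ) :
    Z G w (degreeConstraint (fun _ => 0) fun _ => 1) = matchingPolynomial G w := by
  classical
  rw [Z, matchingPolynomial, sum_filter]
  refine sum_congr rfl fun M _ => ?_
  have : activityWeight G (degreeConstraint (fun _ => 0) fun _ => 1) M =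
      if IsMatching G M then 1 else 0 := by
    rw [isMatching_iff, activityWeight]
    simp [degreeConstraint, prod_ite_zero]
  rw [this]
  split_ifs <;> simp

/-- The empty matching contributes the constant term `1`. This excludes the zero alternative of
nonvanishing. -/
lemma matchingPolynomial_ne_zero [Fintype G.vertexSet] [Fintype G.edgeSet] (w : G.edgeSet → ℂ) :
    matchingPolynomial G w ≠ 0 := by
  classical
  intro h
  have h1 := congrArg (MvPolynomial.eval 0) (Z_eq_matchingPolynomial G w)
  rw [h, map_zero, eval_Z, sum_eq_single ∅] at h1
  · simp [edgeWeight, activityWeight, degreeConstraint, deg] at h1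
  · intro H _ hH
    obtain ⟨e, he⟩ := nonempty_iff_ne_empty.2 hH
    have hsum := sum_deg G H
    have hcard : 0 < #H := card_pos.2 ⟨e, he⟩
    obtain ⟨v, -, hv⟩ := exists_ne_zero_of_sum_ne_zero (by omega : ∑ v, deg G H v ≠ 0)
    rw [prod_eq_zero (mem_univ v) (by simp [hv]), mul_zero]
  · simp

end Graph

end HeilmannLieb

theorem mainTheorem4 {α β : Type*} (G : Graph α β) [Fintype G.vertexSet] [Fintype G.edgeSet]
    (w : G.edgeSet → ℝ) (hw : ∀ e, 0 ≤ w e) :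
    -- degree-constrained subgraphs
    (∀ f g : G.vertexSet → ℕ, (∀ v, f v ≤ g v ∧ g v ≤ f v + 1) →
      HeilmannLieb.IsNonvanishing (HeilmannLieb.sector (Real.pi / 2))
        (HeilmannLieb.Z G (fun e => (w e : ℂ)) (HeilmannLieb.degreeConstraint f g)) ∧
      -- `univariateZ` is the specialization `Z(G,λ,u; y^{1/2} 1)`
      (∀ y t : ℂ, t ^ 2 = y →
        (HeilmannLieb.univariateZ G (fun e => (w e : ℂ))
            (HeilmannLieb.degreeConstraint f g)).eval y =
          MvPolynomial.eval (fun _ => t)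
            (HeilmannLieb.Z G (fun e => (w e : ℂ)) (HeilmannLieb.degreeConstraint f g))) ∧
      HeilmannLieb.IsNonvanishing₁ (HeilmannLieb.sector Real.pi)
        (HeilmannLieb.univariateZ G (fun e => (w e : ℂ))
          (HeilmannLieb.degreeConstraint f g)) ∧
      (HeilmannLieb.univariateZ G (fun e => (w e : ℂ))
          (HeilmannLieb.degreeConstraint f g) ≠ 0 →
        ∀ y : ℂ, (HeilmannLieb.univariateZ G (fun e => (w e : ℂ))
            (HeilmannLieb.degreeConstraint f g)).eval y = 0 → y.im = 0 ∧ y.re ≤ 0)) ∧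
    -- the multivariate Heilmann-Lieb theorem is the case `f = 0`, `g = 1`
    (HeilmannLieb.Z G (fun e => (w e : ℂ))
        (HeilmannLieb.degreeConstraint (fun _ => 0) (fun _ => 1)) =
      HeilmannLieb.matchingPolynomial G (fun e => (w e : ℂ)) ∧
    ∀ x : G.vertexSet → ℂ, (∀ v, x v ∈ HeilmannLieb.sector (Real.pi / 2)) →
      MvPolynomial.eval x (HeilmannLieb.matchingPolynomial G (fun e => (w e : ℂ))) ≠ 0) := by
  have key := HeilmannLieb.isNonvanishing_Z G w hw
  refine ⟨fun f g hfg => ?_, HeilmannLieb.Z_eq_matchingPolynomial G _, fun x hx => ?_⟩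
  · have huni := HeilmannLieb.isNonvanishing_univariateZ G (key f g hfg)
    refine ⟨key f g hfg, ?_, huni, fun h0 y hy => ?_⟩
    · rintro y t rfl
      exact HeilmannLieb.eval_univariateZ G _ _ t
    · by_contra hcon
      exact huni.resolve_left h0 y (HeilmannLieb.mem_sector_pi.2 hcon) hy
  · have h := key (fun _ => 0) (fun _ => 1) (by simp)
    rw [HeilmannLieb.Z_eq_matchingPolynomial] at h
    exact h.resolve_left (HeilmannLieb.matchingPolynomial_ne_zero G _) x hx
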